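/- An instance of adaptive submodular ranking with arbitrary feedback consists of a finite set $U$ of elements with costs $c_e>0$; an arbitrary set $\Gamma$ of feedback states; $m$ scenarios with probabilities $p_1,\dots,p_m\ge 0$ summing to $1$; states $d_{i,e}\in\Gamma$ for every scenario $i\in[m]$ and element $e\in U$; and, for each scenario $i$, a monotone submodular function $f_i:2^{U\times\Gamma}\to[0,1]$. For $S\subseteq U$ write $f_i(S):=f_i(\{(e,d_{i,e}):e\in S\})$; scenario $i$ is covered by $S$ if $f_i(S)=1$, and we assume $f_i(U)=1$ for every $i$. Let $$\epsilon=\min\{f_i(S\cup\{e\})-f_i(S)\;:\; i\in[m],\ S\subseteq U,\ e\in U,\ f_i(S\cup\{e\})>f_i(S)\}$$ (if no increment is positive, then all the costs below are $0$). A solution is a decision tree whose inner nodes are labeled by elements and have one branch for each $t\in\Gamma$. Scenario $i$ traces the root-leaf path that takes the branch $d_{i,e}$ at a node labeled $e$. The tree is feasible if every scenario $i$ is covered by the elements on its path; the cost of scenario $i$ is then the total cost of the shortest prefix of its path that covers $i$, and the expected cost of the tree is the average of these costs with weights $p_i$. The greedy algorithm maintains the set $E\subseteq U$ of displayed elements and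 the set $H\subseteq[m]$ of scenarios that are compatible with the feedback received so far and are not covered by $E$; initially $E=\emptyset$. For an element $e$, let $B_e(H)$ be a set of maximum cardinality among the sets $\{i\in H: d_{i,e}=t\}$, $t\in\Gamma$, and let $L_e(H)=H\setminus B_e(H)$. As long as $H\ne\emptyset$, the algorithm displays an element $e\in U\setminus E$ that maximizes $$\frac1{c_e}\left(\sum_{j\in L_e(H)}p_j+\sum_{i\in H}p_i\,\frac{f_i(E\cup\{e\})-f_i(E)}{1-f_i(E)}\right),$$ with ties, here and in the choice of $B_e(H)$, broken arbitrarily. Theorem. There is an absolute constant $C>0$ such that, for every instance, the greedy algorithm is well defined (it produces a decision tree), and every decision tree that it may produce is feasible and has expected cost at most $$C\left(1+\ln\frac1\epsilon+\ln m\right)$$ times the expected cost of any feasible decision tree. That is, the algorithm is an $O(\log\frac1\epsilon+\log m)$-approximation. -/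

import Mathlib

/-- An instance of adaptive submodular ranking with arbitrary feedback: elements `U`, feedback
states `Γ` (an arbitrary, possibly infinite type) and scenarios `Fin m`. -/
structure ASRInstance (U Γ : Type*) [Fintype U] (m : ℕ) where
  /-- cost of displaying an element -/
  cost : U → ℝ
  cost_pos : ∀ e, 0 < cost e
  /-- probability of each scenario -/
  prob : Fin m → ℝ
  prob_nonneg : ∀ i, 0 ≤ prob i
  prob_sum : ∑ i, prob i = 1
  /-- `state i e` is the feedback given by element `e` under scenario `i` -/
  state : Fin m → U → Γ
  /-- the set functions of the scenarios, on the subsets of `U × Γ` -/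
  f : Fin m → Set (U × Γ) → ℝ
  f_nonneg : ∀ i A, 0 ≤ f i A
  f_le_one : ∀ i A, f i A ≤ 1
  f_mono : ∀ i A B, A ⊆ B → f i A ≤ f i B
  f_submod : ∀ i A B, f i (A ∩ B) + f i (A ∪ B) ≤ f i A + f i B
  /-- every scenario is covered once all elements have been displayed -/
  coverable : ∀ i, f i (Set.range fun e => (e, state i e)) = 1

/-- Decision trees: an inner node displays an element and has one branch for each possible
feedback. -/
inductive DecisionTree (U Γ : Type*) where
  | leaf : DecisionTree U Γ
  | node (e : U) (child : Γ → DecisionTree U Γ) : DecisionTree U Γ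

namespace ASRInstance

variable {U Γ : Type*} [Fintype U] {m : ℕ} (I : ASRInstance U Γ m)

/-- The value of the function of scenario `i` after the elements of `S` have been displayed and
have answered according to scenario `i`. -/
def value (i : Fin m) (S : Set U) : ℝ :=
  I.f i ((fun e => (e, I.state i e)) '' S)

/-- Scenario `i` is covered by the set `S` of elements. -/
def Covered (i : Fin m) (S : Set U) : Prop :=
  I.value i S = 1

/-- The minimum positive incremental value of any element (a minimum over a finite set, unless
no increment is positive, in which case every scenario is covered by the empty set). -/
noncomputable def eps : ℝ :=
  sInf {x : ℝ | ∃ (i : Fin m) (S : Set U) (e : U),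
    I.value i S < I.value i (insert e S) ∧ x = I.value i (insert e S) - I.value i S}

/-- The sequence of elements on the root-leaf path traced by scenario `i`. -/
def path (i : Fin m) : DecisionTree U Γ → List U
  | .leaf => []
  | .node e child => e :: path i (child (I.state i e))

/-- Every scenario is covered at the end of its path. -/
def Feasible (T : DecisionTree U Γ) : Prop :=
  ∀ i, I.Covered i {e | e ∈ I.path i T}

/-- The length of the shortest prefix of the path of scenario `i` that covers `i`. -/
noncomputable def coverLength (i : Fin m) (T : DecisionTree U Γ) : ℕ :=
  sInf {k : ℕ | I.Covered i {e | e ∈ (I.path i T).take k}}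

/-- The cost of scenario `i` in a (feasible) decision tree: the total cost of the shortest
covering prefix of its path. -/
noncomputable def scenarioCost (i : Fin m) (T : DecisionTree U Γ) : ℝ :=
  (((I.path i T).take (I.coverLength i T)).map I.cost).sum

/-- The expected cost of covering the realized scenario. -/
noncomputable def expectedCost (T : DecisionTree U Γ) : ℝ :=
  ∑ i, I.prob i * I.scenarioCost i T

open scoped Classical in
/-- The scenarios of `H` in which the state of `e` is `t`. -/
noncomputable def stateClass (H : Finset (Fin m)) (e : U) (t : Γ) : Finset (Fin m) :=
  H.filter fun i => I.state i e = t

/-- `B` is a class of maximum cardinality among the classes of `H` by the state of `e`. -/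
def IsLargestClass (H : Finset (Fin m)) (e : U) (B : Finset (Fin m)) : Prop :=
  (∃ t, B = I.stateClass H e t) ∧ ∀ t, (I.stateClass H e t).card ≤ B.card

/-- The score of `e` at the state `(E, H)`, where `L ⊆ H` plays the role of `L_e(H)`. -/
noncomputable def score (E : Set U) (H L : Finset (Fin m)) (e : U) : ℝ :=
  1 / I.cost e * (∑ j ∈ L, I.prob j +
    ∑ i ∈ H, I.prob i * ((I.value i (insert e E) - I.value i E) / (1 - I.value i E)))

open scoped Classical in
/-- The scenarios of `H` that are not covered by `E`. -/
noncomputable def uncovered (H : Finset (Fin m)) (E : Set U) : Finset (Fin m) :=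
  H.filter fun i => ¬ I.Covered i E

/-- `I.GreedyFrom E H T`: the tree `T` is a possible outcome of the greedy algorithm started in
the state `(E, H)`, where `E` is the set of displayed elements and `H` the set of compatible
uncovered scenarios. While `H` is nonempty, the algorithm takes for each element `e'` a largest
class `B e'`, puts `L_{e'}(H) = H \ B e'`, and displays an element outside `E` of maximum score.
All ties (among largest classes and among elements) may be broken arbitrarily. -/
inductive GreedyFrom : Set U → Finset (Fin m) → DecisionTree U Γ → Prop
  | done (E : Set U) : GreedyFrom E ∅ .leaf
  | step (E : Set U) (H : Finset (Fin m)) (B : U → Finset (Fin m)) (e : U)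
      (child : Γ → DecisionTree U Γ)
      (hH : H.Nonempty)
      (hB : ∀ e', I.IsLargestClass H e' (B e'))
      (he : e ∉ E)
      (hmax : ∀ e', e' ∉ E → I.score E H (H \ B e') e' ≤ I.score E H (H \ B e) e)
      (hchild : ∀ t, GreedyFrom (insert e E)
        (I.uncovered (I.stateClass H e t) (insert e E)) (child t)) :
      GreedyFrom E H (.node e child)

/-- `T` is a decision tree that the greedy algorithm may produce. -/
def IsGreedyTree (T : DecisionTree U Γ) : Prop :=
  I.GreedyFrom ∅ (I.uncovered Finset.univ ∅) T

end ASRInstance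

namespace ASRInstance

variable {U Γ : Type*} [Fintype U] {m : ℕ} (I : ASRInstance U Γ m)

/-! Fix a greedy state `(E, H)` and a feasible tree `T`. Follow in `T` the branches of the largest
classes up to cost `τ`. A scenario of `H` that `T` covers within `τ` either leaves this stem at some
`e`, so it lies in `L_e(H)`, or is covered by the stem, so by submodularity its relative gains there
sum to at least 1. Either way its credits along the stem total at least 1. Averaging over the stem,
the greedy score is at least 1/`τ` times the mass of these scenarios (`sum_prob_le_mul_score`).

A scenario cannot collect much credit along its greedy path: leaving the largest class at least
halves the compatible set, and relative gains are bounded by a logarithm of the residual, which is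
at least `eps` until coverage. `potential` bounds the total.

Apply the score bound when greedy finishes displaying an element at elapsed cost `s`, with `τ = s /
L`, and sum over the greedy tree (`GreedyFrom.sum_remainingCost_le`). With `r` and `o` the greedy
and `T` costs, this bounds the mean of `r` by the mean of `(r / L) * potential + L * o`. For `L`
about twice the potential the first term is at most `r / 2` and is absorbed. -/

/-! ### Increments of the coverage functions, and `eps` -/

theorem value_mono (i : Fin m) {S S' : Set U} (h : S ⊆ S') : I.value i S ≤ I.value i S' :=
  I.f_mono i _ _ (Set.image_mono h)

theorem value_nonneg (i : Fin m) (S : Set U) : 0 ≤ I.value i S := I.f_nonneg i _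

theorem value_le_one (i : Fin m) (S : Set U) : I.value i S ≤ 1 := I.f_le_one i _

theorem value_univ (i : Fin m) : I.value i Set.univ = 1 := by
  rw [value, Set.image_univ]
  exact I.coverable i

theorem Covered.mono {I : ASRInstance U Γ m} {i : Fin m} {S S' : Set U} (h : I.Covered i S)
    (hS : S ⊆ S') : I.Covered i S' :=
  le_antisymm (I.value_le_one i S') (h.symm.le.trans (I.value_mono i hS))

theorem value_lt_one {I : ASRInstance U Γ m} {i : Fin m} {S : Set U} (h : ¬ I.Covered i S) :
    I.value i S < 1 :=
  lt_of_le_of_ne (I.value_le_one i S) h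

theorem value_submod (i : Fin m) (S S' : Set U) :
    I.value i (S ∩ S') + I.value i (S ∪ S') ≤ I.value i S + I.value i S' := by
  have h := I.f_submod i ((fun e => (e, I.state i e)) '' S) ((fun e => (e, I.state i e)) '' S')
  rw [← Set.image_union, ← Set.image_inter fun a b hab => congrArg Prod.fst hab] at h
  exact h

/-- Subadditivity of the increments of a submodular function. -/
theorem value_union_sub_le (i : Fin m) (E : Set U) (Q : List U) :
    I.value i (E ∪ {e | e ∈ Q}) - I.value i E ≤
      (Q.map fun e => I.value i (insert e E) - I.value i E).sum := by
  induction Q with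
  | nil => simp
  | cons e Q ih =>
    have h := I.value_submod i (insert e E) (E ∪ {x | x ∈ Q})
    have h1 : I.value i E ≤ I.value i (insert e E ∩ (E ∪ {x | x ∈ Q})) :=
      I.value_mono i (Set.subset_inter (Set.subset_insert _ _) Set.subset_union_left)
    have h2 : insert e E ∪ (E ∪ {x | x ∈ Q}) = E ∪ {x | x ∈ e :: Q} := by
      ext x
      simp only [Set.mem_union, Set.mem_insert_iff, Set.mem_ofPred_eq, List.mem_cons]
      tauto
    rw [h2] at h
    rw [List.map_cons, List.sum_cons]
    linarith

theorem exists_value_lt_insert {i : Fin m} {E : Set U} (h : ¬ I.Covered i E) :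
    ∃ e, I.value i E < I.value i (insert e E) := by
  by_contra! hcon
  have h1 := I.value_union_sub_le i E Finset.univ.toList
  have h2 : E ∪ {e | e ∈ (Finset.univ : Finset U).toList} = Set.univ := by
    ext x; simp
  have h3 : ((Finset.univ : Finset U).toList.map
      fun e => I.value i (insert e E) - I.value i E).sum ≤ 0 := by
    rw [Finset.sum_map_toList]
    exact Finset.sum_nonpos fun e _ => sub_nonpos.2 (hcon e)
  rw [h2, value_univ] at h1
  linarith [value_lt_one h]

/-- Some element has a positive increment over `E`, and that increment is at most the residual `1 -
I.value i E`. Positivity holds because only finitely many increments exist. -/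
theorem eps_pos_and_le {i : Fin m} {E : Set U} (h : ¬ I.Covered i E) :
    0 < I.eps ∧ I.eps ≤ 1 - I.value i E := by
  obtain ⟨e, he⟩ := I.exists_value_lt_insert h
  set A : Set ℝ := {x : ℝ | ∃ (i : Fin m) (S : Set U) (e : U),
    I.value i S < I.value i (insert e S) ∧ x = I.value i (insert e S) - I.value i S} with hA
  have hfin : A.Finite := by
    refine (Set.finite_range fun q : Fin m × Set U × U =>
      I.value q.1 (insert q.2.2 q.2.1) - I.value q.1 q.2.1).subset ?_
    rintro x ⟨i, S, e, -, rfl⟩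
    exact ⟨(i, S, e), rfl⟩
  have hmem : I.value i (insert e E) - I.value i E ∈ A := ⟨i, E, e, he, rfl⟩
  constructor
  · obtain ⟨j, S, a, hlt, heq⟩ : sInf A ∈ A := Set.Nonempty.csInf_mem ⟨_, hmem⟩ hfin
    change 0 < sInf A
    rw [heq]
    linarith
  · have h1 : I.eps ≤ I.value i (insert e E) - I.value i E := csInf_le hfin.bddBelow hmem
    linarith [I.value_le_one i (insert e E)]

theorem log_one_div_eps_nonneg : 0 ≤ Real.log (1 / I.eps) := by
  by_cases h : ∃ (i : Fin m) (E : Set U), ¬ I.Covered i E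
  · obtain ⟨i, E, h⟩ := h
    obtain ⟨h0, h1⟩ := I.eps_pos_and_le h
    refine Real.log_nonneg ((one_le_div h0).2 ?_)
    linarith [I.value_nonneg i E]
  · push Not at h
    -- With no positive increment, `eps` is `sInf ∅ = 0`, and the logarithm takes its default value
    -- 0.
    have : I.eps = 0 := by
      rw [eps, ← Real.sInf_empty]
      congr 1
      rw [Set.eq_empty_iff_forall_notMem]
      rintro x ⟨i, S, e, hlt, -⟩
      have h1 : I.value i S = 1 := h i S
      linarith [I.value_le_one i (insert e S)]
    simp [this]

/-! ### Existence and feasibility of greedy trees -/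

theorem mem_stateClass {H : Finset (Fin m)} {e : U} {t : Γ} {i : Fin m} :
    i ∈ I.stateClass H e t ↔ i ∈ H ∧ I.state i e = t := by
  simp [stateClass]

theorem mem_uncovered {H : Finset (Fin m)} {E : Set U} {i : Fin m} :
    i ∈ I.uncovered H E ↔ i ∈ H ∧ ¬ I.Covered i E := by
  simp [uncovered]

theorem stateClass_subset (H : Finset (Fin m)) (e : U) (t : Γ) : I.stateClass H e t ⊆ H :=
  fun _ hi => (I.mem_stateClass.1 hi).1

theorem exists_isLargestClass {H : Finset (Fin m)} (hH : H.Nonempty) (e : U) :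
    ∃ B, I.IsLargestClass H e B := by
  obtain ⟨i, -⟩ := hH
  have hfin : (Set.range fun t => I.stateClass H e t).Finite := Set.toFinite _
  obtain ⟨B, ⟨t, rfl⟩, hB⟩ :=
    Set.exists_max_image _ Finset.card hfin ⟨_, ⟨I.state i e, rfl⟩⟩
  exact ⟨_, ⟨t, rfl⟩, fun t' => hB _ ⟨t', rfl⟩⟩

theorem exists_greedyFrom (E : Set U) (H : Finset (Fin m)) (hE : ∀ i ∈ H, ¬ I.Covered i E) :
    ∃ T, I.GreedyFrom E H T := by
  induction hn : (Eᶜ).ncard using Nat.strong_induction_on generalizing E H with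
  | _ n ih =>
    rcases H.eq_empty_or_nonempty with rfl | hH
    · exact ⟨_, .done E⟩
    choose B hB using I.exists_isLargestClass hH
    have hne : (Eᶜ).Nonempty := by
      rw [Set.nonempty_compl]
      rintro rfl
      obtain ⟨i, hi⟩ := hH
      exact hE i hi (I.value_univ i)
    obtain ⟨e, he, hmax⟩ := Set.exists_max_image Eᶜ
      (fun e => I.score E H (H \ B e) e) (Set.toFinite _) hne
    have hch : ∀ t, ∃ T, I.GreedyFrom (insert e E)
        (I.uncovered (I.stateClass H e t) (insert e E)) T := fun t => by
      refine ih _ ?_ _ _ (fun i hi => (I.mem_uncovered.1 hi).2) rfl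
      rw [← hn]
      refine Set.ncard_lt_ncard ?_ (Set.toFinite _)
      refine ⟨Set.compl_subset_compl.2 (Set.subset_insert _ _), fun h => ?_⟩
      exact h he (Set.mem_insert _ _)
    choose child hchild using hch
    exact ⟨_, .step E H B e child hH hB he (fun e' he' => hmax e' he') hchild⟩

theorem GreedyFrom.covered {I : ASRInstance U Γ m} {E : Set U} {H : Finset (Fin m)}
    {T : DecisionTree U Γ} (h : I.GreedyFrom E H T) :
    ∀ i ∈ H, I.Covered i (E ∪ {e | e ∈ I.path i T}) := by
  induction h with
  | done E => simp
  | step E H B e child hH hB he hmax hchild ih =>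
    intro i hi
    have hsub : insert e E ∪ {x | x ∈ I.path i (child (I.state i e))} =
        E ∪ {x | x ∈ I.path i (.node e child)} := by
      ext x
      simp only [path, Set.mem_union, Set.mem_insert_iff, Set.mem_ofPred_eq, List.mem_cons]
      tauto
    rw [← hsub]
    by_cases hc : I.Covered i (insert e E)
    · exact hc.mono Set.subset_union_left
    · exact ih (I.state i e) i (I.mem_uncovered.2 ⟨I.mem_stateClass.2 ⟨hi, rfl⟩, hc⟩)

theorem IsGreedyTree.feasible {I : ASRInstance U Γ m} {A : DecisionTree U Γ}
    (h : I.IsGreedyTree A) : I.Feasible A := by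
  intro i
  by_cases hc : I.Covered i ∅
  · exact hc.mono (Set.empty_subset _)
  · simpa using GreedyFrom.covered h i (I.mem_uncovered.2 ⟨Finset.mem_univ i, hc⟩)

/-! ### Costs along a path -/

open scoped Classical in
/-- The cost of covering scenario `i` along a list of elements, once `E` has been displayed. -/
noncomputable def remainingCost (i : Fin m) : Set U → List U → ℝ
  | _, [] => 0
  | E, e :: l => if I.Covered i E then 0 else I.cost e + remainingCost i (insert e E) l

theorem remainingCost_of_covered {i : Fin m} {E : Set U} (h : I.Covered i E) (l : List U) :
    I.remainingCost i E l = 0 := by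
  cases l <;> simp [remainingCost, h]

theorem remainingCost_cons {i : Fin m} {E : Set U} (h : ¬ I.Covered i E) (e : U) (l : List U) :
    I.remainingCost i E (e :: l) = I.cost e + I.remainingCost i (insert e E) l := by
  simp [remainingCost, h]

theorem remainingCost_nonneg (i : Fin m) (E : Set U) (l : List U) :
    0 ≤ I.remainingCost i E l := by
  induction l generalizing E with
  | nil => simp [remainingCost]
  | cons e l ih =>
    by_cases h : I.Covered i E
    · rw [I.remainingCost_of_covered h]
    · rw [I.remainingCost_cons h]
      exact add_nonneg (I.cost_pos e).le (ih _)

theorem exists_covering_prefix (i : Fin m) (E : Set U) (l : List U)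
    (h : I.Covered i (E ∪ {e | e ∈ l})) :
    ∃ k, I.Covered i (E ∪ {e | e ∈ l.take k}) ∧
      ((l.take k).map I.cost).sum ≤ I.remainingCost i E l := by
  induction l generalizing E with
  | nil => exact ⟨0, by simpa using h, by simp [remainingCost]⟩
  | cons e l ih =>
    by_cases hc : I.Covered i E
    · exact ⟨0, by simpa using hc, by simpa using I.remainingCost_nonneg i E _⟩
    · have key : ∀ l : List U, insert e E ∪ {x | x ∈ l} = E ∪ {x | x ∈ e :: l} := by
        intro l
        ext x
        simp only [Set.mem_union, Set.mem_insert_iff, Set.mem_ofPred_eq, List.mem_cons]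
        tauto
      obtain ⟨k, hk, hk'⟩ := ih (insert e E) (by rwa [key])
      refine ⟨k + 1, by rwa [List.take_succ_cons, ← key], ?_⟩
      rw [I.remainingCost_cons hc, List.take_succ_cons, List.map_cons, List.sum_cons]
      linarith

theorem sum_map_cost_nonneg (l : List U) : 0 ≤ (l.map I.cost).sum := by
  apply List.sum_nonneg
  simp only [List.mem_map]
  rintro _ ⟨e, -, rfl⟩
  exact (I.cost_pos e).le

theorem sum_map_cost_take_mono (l : List U) {j k : ℕ} (h : j ≤ k) :
    ((l.take j).map I.cost).sum ≤ ((l.take k).map I.cost).sum := by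
  obtain ⟨d, rfl⟩ := Nat.exists_eq_add_of_le h
  rw [List.take_add, List.map_append, List.sum_append]
  linarith [I.sum_map_cost_nonneg ((l.drop j).take d)]

theorem scenarioCost_nonneg (i : Fin m) (T : DecisionTree U Γ) : 0 ≤ I.scenarioCost i T :=
  I.sum_map_cost_nonneg _

theorem scenarioCost_le_remainingCost {i : Fin m} {T : DecisionTree U Γ} (h : I.Feasible T) :
    I.scenarioCost i T ≤ I.remainingCost i ∅ (I.path i T) := by
  obtain ⟨k, hk, hk'⟩ := I.exists_covering_prefix i ∅ (I.path i T) (by simpa using h i)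
  rw [Set.empty_union] at hk
  exact (I.sum_map_cost_take_mono _ (Nat.sInf_le hk)).trans hk'

theorem covered_take_coverLength {i : Fin m} {T : DecisionTree U Γ} (h : I.Feasible T) :
    I.Covered i {e | e ∈ (I.path i T).take (I.coverLength i T)} := by
  have hne : {k : ℕ | I.Covered i {e | e ∈ (I.path i T).take k}}.Nonempty :=
    ⟨(I.path i T).length, by simpa using h i⟩
  exact Nat.sInf_mem hne

/-! ### Greedy score against an arbitrary feasible tree -/

/-- The stem of `T` of total cost at most `τ` that follows the largest classes of `H`: every
scenario of `H` either leaves the stem or has all its prefixes of cost at most `τ` on it. -/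
theorem exists_stem {H : Finset (Fin m)} {B : U → Finset (Fin m)}
    (hB : ∀ e, I.IsLargestClass H e (B e)) (T : DecisionTree U Γ) {τ : ℝ} (hτ : 0 ≤ τ) :
    ∃ Q : List U, (Q.map I.cost).sum ≤ τ ∧ ∀ i ∈ H, (∃ e ∈ Q, i ∉ B e) ∨
      ∀ k, (((I.path i T).take k).map I.cost).sum ≤ τ → ∀ e ∈ (I.path i T).take k, e ∈ Q := by
  induction T generalizing τ with
  | leaf => exact ⟨[], by simpa using hτ, fun i _ => Or.inr (by simp [path])⟩
  | node e child ih =>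
    rcases lt_or_ge τ (I.cost e) with hlt | hle
    -- The root exceeds the budget, so only the empty prefix of any path costs at most `τ`.
    · refine ⟨[], by simpa using hτ, fun i _ => Or.inr ?_⟩
      rintro (_ | k) hk
      · simp
      · rw [path, List.take_succ_cons, List.map_cons, List.sum_cons] at hk
        linarith [I.sum_map_cost_nonneg ((I.path i (child (I.state i e))).take k)]
    · obtain ⟨t, ht⟩ := (hB e).1
      obtain ⟨Q, hQ, hQ'⟩ := ih t (sub_nonneg.2 hle)
      refine ⟨e :: Q, by rw [List.map_cons, List.sum_cons]; linarith, fun i hi => ?_⟩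
      by_cases hiB : i ∈ B e
      · have hst : I.state i e = t := (I.mem_stateClass.1 (ht ▸ hiB)).2
        rcases hQ' i hi with ⟨a, ha, hia⟩ | h
        · exact Or.inl ⟨a, List.mem_cons_of_mem _ ha, hia⟩
        · refine Or.inr ?_
          rintro (_ | k) hk
          · simp
          · rw [path, hst, List.take_succ_cons] at hk ⊢
            rw [List.map_cons, List.sum_cons] at hk
            intro x hx
            rcases List.mem_cons.1 hx with rfl | hx
            · exact List.mem_cons_self
            · exact List.mem_cons_of_mem _ (h k (by linarith) x hx)
      · exact Or.inl ⟨e, List.mem_cons_self, hiB⟩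

/-- The relative increment of scenario `i` when `e` is displayed after `E`. -/
noncomputable def gain (i : Fin m) (E : Set U) (e : U) : ℝ :=
  (I.value i (insert e E) - I.value i E) / (1 - I.value i E)

theorem gain_nonneg (i : Fin m) (E : Set U) (e : U) : 0 ≤ I.gain i E e :=
  div_nonneg (sub_nonneg.2 (I.value_mono i (Set.subset_insert e E)))
    (sub_nonneg.2 (I.value_le_one i E))

/-- The contribution of scenario `i` to the score of an element with largest class `B`. -/
noncomputable def credit (i : Fin m) (E : Set U) (B : Finset (Fin m)) (e : U) : ℝ :=
  (if i ∈ B then 0 else 1) + I.gain i E e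

theorem credit_nonneg (i : Fin m) (E : Set U) (B : Finset (Fin m)) (e : U) :
    0 ≤ I.credit i E B e := by
  have := I.gain_nonneg i E e
  rw [credit]
  split_ifs <;> linarith

theorem cost_mul_score (E : Set U) (H B : Finset (Fin m)) (e : U) :
    I.cost e * I.score E H (H \ B) e = ∑ i ∈ H, I.prob i * I.credit i E B e := by
  have h : ∑ j ∈ H \ B, I.prob j = ∑ i ∈ H, I.prob i * (if i ∈ B then 0 else 1) := by
    rw [← Finset.filter_notMem_eq_sdiff, Finset.sum_filter]
    refine Finset.sum_congr rfl fun i _ => ?_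
    split_ifs <;> simp
  rw [score, ← mul_assoc, mul_one_div_cancel (I.cost_pos e).ne', one_mul, h,
    ← Finset.sum_add_distrib]
  exact Finset.sum_congr rfl fun i _ => by rw [credit, gain]; ring

theorem score_nonneg (E : Set U) (H B : Finset (Fin m)) (e : U) :
    0 ≤ I.score E H (H \ B) e := by
  have h := I.cost_mul_score E H B e
  refine nonneg_of_mul_nonneg_right ?_ (I.cost_pos e)
  rw [h]
  exact Finset.sum_nonneg fun i _ => mul_nonneg (I.prob_nonneg i) (I.credit_nonneg i E B e)

theorem one_le_sum_gain {i : Fin m} {E : Set U} (hE : ¬ I.Covered i E) {Q : List U}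
    (hQ : I.Covered i {e | e ∈ Q}) : 1 ≤ (Q.map fun e => I.gain i E e).sum := by
  have h1 := I.value_union_sub_le i E Q
  have h2 : I.value i (E ∪ {e | e ∈ Q}) = 1 := hQ.mono Set.subset_union_right
  have h3 := value_lt_one hE
  have h4 : (Q.map fun e => I.gain i E e).sum =
      (Q.map fun e => I.value i (insert e E) - I.value i E).sum / (1 - I.value i E) := by
    simp only [gain, div_eq_mul_inv]
    rw [List.sum_map_mul_right]
  rw [h4, le_div_iff₀ (by linarith)]
  linarith

/-- The stem of `T` may reuse displayed elements, over which greedy does not maximize. These score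
0, since `H` forms a single class there and no value increases. -/
theorem score_eq_zero_of_mem {E : Set U} {H B : Finset (Fin m)} {e : U} (he : e ∈ E)
    (hsame : ∀ i ∈ H, ∀ j ∈ H, I.state i e = I.state j e) (hB : I.IsLargestClass H e B) :
    I.score E H (H \ B) e = 0 := by
  have hBH : H ⊆ B := by
    intro i hi
    obtain ⟨⟨t, rfl⟩, hmax⟩ := hB
    have h1 : I.stateClass H e (I.state i e) = H :=
      (I.stateClass_subset _ _ _).antisymm
        fun j hj => I.mem_stateClass.2 ⟨hj, hsame j hj i hi⟩
    have h2 := hmax (I.state i e)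
    rw [h1] at h2
    rw [Finset.eq_of_subset_of_card_le (I.stateClass_subset H e t) h2]
    exact hi
  simp [score, Set.insert_eq_of_mem he, Finset.sdiff_eq_empty_iff_subset.2 hBH]

/-- The maximum score compares with the scenarios that `T` covers at cost at most `τ`. -/
theorem sum_prob_le_mul_score {E : Set U} {H : Finset (Fin m)} {B : U → Finset (Fin m)} {e : U}
    (hE : ∀ i ∈ H, ¬ I.Covered i E)
    (hsame : ∀ a ∈ E, ∀ i ∈ H, ∀ j ∈ H, I.state i a = I.state j a)
    (hB : ∀ a, I.IsLargestClass H a (B a))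
    (hmax : ∀ a, a ∉ E → I.score E H (H \ B a) a ≤ I.score E H (H \ B e) e)
    {T : DecisionTree U Γ} (hT : I.Feasible T) {τ : ℝ} (hτ : 0 ≤ τ) :
    ∑ i ∈ H, I.prob i * (if I.scenarioCost i T ≤ τ then 1 else 0) ≤
      τ * I.score E H (H \ B e) e := by
  obtain ⟨Q, hQ, hstem⟩ := I.exists_stem hB T hτ
  set s := I.score E H (H \ B e) e with hs
  have hs0 : 0 ≤ s := I.score_nonneg E H (B e) e
  have hle : ∀ a, I.score E H (H \ B a) a ≤ s := fun a => by
    by_cases ha : a ∈ E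
    · rw [I.score_eq_zero_of_mem ha (hsame a ha) (hB a)]
      exact hs0
    · exact hmax a ha
  calc ∑ i ∈ H, I.prob i * (if I.scenarioCost i T ≤ τ then 1 else 0)
      ≤ ∑ i ∈ H, I.prob i * (Q.map fun a => I.credit i E (B a) a).sum := by
        refine Finset.sum_le_sum fun i hi => mul_le_mul_of_nonneg_left ?_ (I.prob_nonneg i)
        have hnn : ∀ x ∈ Q.map fun a => I.credit i E (B a) a, 0 ≤ x := by
          simp only [List.mem_map]
          rintro _ ⟨a, -, rfl⟩
          exact I.credit_nonneg _ _ _ _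
        split_ifs with hc
        · rcases hstem i hi with ⟨a, ha, hia⟩ | h
          · refine le_trans ?_ (List.single_le_sum hnn _ (List.mem_map_of_mem ha))
            rw [credit, if_neg hia]
            linarith [I.gain_nonneg i E a]
          · have hcov : I.Covered i {a | a ∈ Q} :=
              (I.covered_take_coverLength hT).mono fun a ha => h _ hc a ha
            refine (I.one_le_sum_gain (hE i hi) hcov).trans
              (List.sum_le_sum fun a _ => ?_)
            rw [credit]
            split_ifs <;> linarith
        · exact List.sum_nonneg hnn
    _ = (Q.map fun a => I.cost a * I.score E H (H \ B a) a).sum := by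
        simp only [cost_mul_score]
        clear hstem hQ
        induction Q with
        | nil => simp
        | cons a Q ih =>
          simp only [List.map_cons, List.sum_cons, mul_add, Finset.sum_add_distrib] at ih ⊢
          rw [ih]
    _ ≤ (Q.map fun a => I.cost a * s).sum :=
        List.sum_le_sum fun a _ => mul_le_mul_of_nonneg_left (hle a) (I.cost_pos a).le
    _ = (Q.map I.cost).sum * s := by rw [List.sum_map_mul_right]
    _ ≤ τ * s := mul_le_mul_of_nonneg_right hQ hs0

/-! ### Bounding the credit collected by a scenario -/

/-- An upper bound on the total credit that scenario `i` can still receive. -/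
noncomputable def potential (i : Fin m) (E : Set U) (H : Finset (Fin m)) : ℝ :=
  Real.log H.card / Real.log 2 + 1 + Real.log ((1 - I.value i E) / I.eps)

/-- The class of `i` is disjoint from `B` and no larger than it. -/
theorem two_mul_card_stateClass_le {H B : Finset (Fin m)} {e : U} (hB : I.IsLargestClass H e B)
    {i : Fin m} (hiB : i ∉ B) (hi : i ∈ H) :
    2 * (I.stateClass H e (I.state i e)).card ≤ H.card := by
  obtain ⟨⟨t, rfl⟩, hmax⟩ := hB
  have hne : I.state i e ≠ t := fun h => hiB (I.mem_stateClass.2 ⟨hi, h⟩)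
  have hdisj : Disjoint (I.stateClass H e (I.state i e)) (I.stateClass H e t) := by
    rw [Finset.disjoint_left]
    intro j hj hj'
    exact hne ((I.mem_stateClass.1 hj).2.symm.trans (I.mem_stateClass.1 hj').2)
  have h1 := Finset.card_le_card
    (Finset.union_subset (I.stateClass_subset H e (I.state i e)) (I.stateClass_subset H e t))
  rw [Finset.card_union_of_disjoint hdisj] at h1
  have := hmax (I.state i e)
  omega

theorem log_card_add_le {H B : Finset (Fin m)} {e : U} (hB : I.IsLargestClass H e B)
    {i : Fin m} (hi : i ∈ H) {H' : Finset (Fin m)} (hne : H'.Nonempty)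
    (hH' : H' ⊆ I.stateClass H e (I.state i e)) :
    (if i ∈ B then 0 else 1) + Real.log H'.card / Real.log 2 ≤
      Real.log H.card / Real.log 2 := by
  have hl2 : 0 < Real.log 2 := Real.log_pos one_lt_two
  have hpos : (0 : ℝ) < H'.card := by exact_mod_cast hne.card_pos
  split_ifs with hiB
  · rw [zero_add]
    refine div_le_div_of_nonneg_right (Real.log_le_log hpos ?_) hl2.le
    exact_mod_cast Finset.card_le_card (hH'.trans (I.stateClass_subset _ _ _))
  · have h1 : 2 * H'.card ≤ H.card :=
      (Nat.mul_le_mul_left 2 (Finset.card_le_card hH')).trans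
        (I.two_mul_card_stateClass_le hB hiB hi)
    have h2 : Real.log (2 * H'.card) ≤ Real.log H.card :=
      Real.log_le_log (by positivity) (by exact_mod_cast h1)
    rw [Real.log_mul two_ne_zero hpos.ne'] at h2
    rw [← div_self hl2.ne', ← add_div]
    exact div_le_div_of_nonneg_right h2 hl2.le

/-- The class part of the credit is paid by the halving of `H`; the gain is `1 - x ≤ -log x`, with
`x` the ratio of the new residual to the old. -/
theorem credit_add_potential_le {E : Set U} {H B : Finset (Fin m)} {e : U}
    (hB : I.IsLargestClass H e B) {i : Fin m} (hi : i ∈ H) (hE : ¬ I.Covered i E)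
    (hE' : ¬ I.Covered i (insert e E)) :
    I.credit i E B e + I.potential i (insert e E)
      (I.uncovered (I.stateClass H e (I.state i e)) (insert e E)) ≤ I.potential i E H := by
  have h1 := I.log_card_add_le hB hi
    (H' := I.uncovered (I.stateClass H e (I.state i e)) (insert e E))
    ⟨i, I.mem_uncovered.2 ⟨I.mem_stateClass.2 ⟨hi, rfl⟩, hE'⟩⟩
    fun j hj => (I.mem_uncovered.1 hj).1
  have h2 : I.gain i E e + Real.log ((1 - I.value i (insert e E)) / I.eps) ≤
      Real.log ((1 - I.value i E) / I.eps) := by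
    have heps := (I.eps_pos_and_le hE).1
    have ha : 0 < 1 - I.value i E := sub_pos.2 (value_lt_one hE)
    have hb : 0 < 1 - I.value i (insert e E) := sub_pos.2 (value_lt_one hE')
    have h3 := Real.log_le_sub_one_of_pos (div_pos hb ha)
    rw [Real.log_div hb.ne' ha.ne'] at h3
    rw [Real.log_div hb.ne' heps.ne', Real.log_div ha.ne' heps.ne']
    have h4 : I.gain i E e = 1 - (1 - I.value i (insert e E)) / (1 - I.value i E) := by
      rw [gain]
      field_simp
      ring
    linarith
  rw [credit, potential, potential]
  linarith

/-- At the covering step the new residual is 0 and has no usable logarithm; the summand 1 of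
`potential` pays for this last gain. -/
theorem credit_le_potential {E : Set U} {H B : Finset (Fin m)} {e : U}
    (hB : I.IsLargestClass H e B) {i : Fin m} (hi : i ∈ H) (hE : ¬ I.Covered i E) :
    I.credit i E B e ≤ I.potential i E H := by
  have h1 := I.log_card_add_le hB hi (H' := {i}) (Finset.singleton_nonempty i)
    (Finset.singleton_subset_iff.2 (I.mem_stateClass.2 ⟨hi, rfl⟩))
  rw [Finset.card_singleton, Nat.cast_one, Real.log_one, zero_div, add_zero] at h1
  obtain ⟨h0, h2⟩ := I.eps_pos_and_le hE
  have h3 := Real.log_nonneg ((one_le_div h0).2 h2)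
  have h4 : I.gain i E e ≤ 1 := by
    rw [gain]
    exact div_le_one_of_le₀ (by linarith [I.value_le_one i (insert e E)])
      (sub_nonneg.2 (I.value_le_one i E))
  rw [credit, potential]
  linarith

/-! ### Charging the greedy cost -/

/-- `σ` is the cost spent before reaching the state. Each credit is weighted by the elapsed cost
divided by `L`, at most the final elapsed cost of its scenario; `max 0 (L * o - σ)` pays for the
greedy cost incurred before time `L * o`. -/
theorem GreedyFrom.sum_remainingCost_le {I : ASRInstance U Γ m} {E : Set U} {H : Finset (Fin m)}
    {A : DecisionTree U Γ} (h : I.GreedyFrom E H A) {T : DecisionTree U Γ} (hT : I.Feasible T)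
    {L : ℝ} (hL : 0 < L) {σ : ℝ} (hσ : 0 ≤ σ)
    (hE : ∀ i ∈ H, ¬ I.Covered i E)
    (hsame : ∀ a ∈ E, ∀ i ∈ H, ∀ j ∈ H, I.state i a = I.state j a) :
    0 ≤ ∑ i ∈ H, I.prob i * ((σ + I.remainingCost i E (I.path i A)) / L * I.potential i E H +
      max 0 (L * I.scenarioCost i T - σ) - I.remainingCost i E (I.path i A)) := by
  classical
  induction h generalizing σ with
  | done E => simp
  | step E H B e child hH hB he hmax hchild ih =>
    have hc := I.cost_pos e
    have hσ' : 0 < σ + I.cost e := by linarith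
    -- The score bound at `τ = (σ + I.cost e) / L`, multiplied by the cost of `e`.
    have hnode : 0 ≤ ∑ i ∈ H, I.prob i * ((σ + I.cost e) / L * I.credit i E (B e) e -
        I.cost e * (if I.scenarioCost i T ≤ (σ + I.cost e) / L then 1 else 0)) := by
      have h1 := mul_le_mul_of_nonneg_left
        (I.sum_prob_le_mul_score hE hsame hB hmax hT (div_pos hσ' hL).le) hc.le
      have h2 := I.cost_mul_score E H (B e) e
      have h3 : I.cost e * ((σ + I.cost e) / L * I.score E H (H \ B e) e) =
          (σ + I.cost e) / L * ∑ i ∈ H, I.prob i * I.credit i E (B e) e := by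
        rw [← h2]; ring
      rw [h3, Finset.mul_sum, Finset.mul_sum, ← sub_nonneg, ← Finset.sum_sub_distrib] at h1
      refine h1.trans_eq (Finset.sum_congr rfl fun i _ => by ring)
    refine hnode.trans ?_
    -- The rest splits over the branches of `e`; scenarios that `e` covers drop out of the induction
    -- hypothesis and use only the node term.
    rw [← sub_nonneg, ← Finset.sum_sub_distrib,
      ← Finset.sum_fiberwise_of_maps_to (g := fun i => I.state i e)
        (t := H.image fun i => I.state i e) fun i hi => Finset.mem_image_of_mem _ hi]
    refine Finset.sum_nonneg fun t _ => ?_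
    have hcl : (H.filter fun i => I.state i e = t) = I.stateClass H e t := by
      ext i; simp [mem_stateClass]
    have hun : I.uncovered (I.stateClass H e t) (insert e E) =
        (I.stateClass H e t).filter fun i => ¬ I.Covered i (insert e E) := by
      ext i; simp [mem_uncovered]
    rw [hcl]
    have IH := ih t hσ'.le (fun i hi => (I.mem_uncovered.1 hi).2) (by
      intro a ha i hi j hj
      have hi' := I.mem_stateClass.1 (I.mem_uncovered.1 hi).1
      have hj' := I.mem_stateClass.1 (I.mem_uncovered.1 hj).1
      rcases ha with rfl | ha
      · rw [hi'.2, hj'.2]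
      · exact hsame a ha i hi'.1 j hj'.1)
    refine IH.trans ?_
    rw [Finset.sum_congr hun fun _ _ => rfl, Finset.sum_filter]
    refine Finset.sum_le_sum fun i hi => ?_
    obtain ⟨hiH, rfl⟩ := I.mem_stateClass.1 hi
    have hiE := hE i hiH
    rw [path, I.remainingCost_cons hiE, ← mul_sub]
    set r := I.remainingCost i (insert e E) (I.path i (child (I.state i e))) with hr
    have hr0 : 0 ≤ r := I.remainingCost_nonneg _ _ _
    have hcr := I.credit_nonneg i E (B e) e
    set o := I.scenarioCost i T
    set w : ℝ := (σ + I.cost e) / L with hw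
    set v : ℝ := r / L with hv
    have hw0 : 0 ≤ w := (div_pos hσ' hL).le
    have hv0 : 0 ≤ v := div_nonneg hr0 hL.le
    have hwv : (σ + (I.cost e + r)) / L = w + v := by rw [hw, hv, ← add_div]; ring
    have hwv' : (σ + I.cost e + r) / L = w + v := by rw [hw, hv, ← add_div]
    -- Either the indicator cancels the cost of `e`, or `L * o` lies beyond `σ + I.cost e` and the
    -- maximum falls by exactly that cost.
    have hopt : max 0 (L * o - (σ + I.cost e)) + I.cost e -
        I.cost e * (if o ≤ w then 1 else 0) ≤ max 0 (L * o - σ) := by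
      split_ifs with ho
      · have : max 0 (L * o - (σ + I.cost e)) ≤ max 0 (L * o - σ) :=
          max_le_max le_rfl (by linarith)
        linarith
      · have h1 : σ + I.cost e < L * o := by
          rw [mul_comm]
          exact (div_lt_iff₀ hL).1 (not_le.1 ho)
        rw [max_eq_right (by linarith), max_eq_right (by linarith)]
        linarith
    have hpi := I.prob_nonneg i
    by_cases hcov : I.Covered i (insert e E)
    · rw [if_neg (not_not.2 hcov)]
      refine mul_nonneg hpi ?_
      have hr' : r = 0 := I.remainingCost_of_covered hcov _
      have hpot := I.credit_le_potential (hB e) hiH hiE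
      have h1 := mul_le_mul_of_nonneg_left hpot (add_nonneg hw0 hv0)
      have h2 := mul_nonneg hv0 hcr
      have h3 := le_max_left 0 (L * o - (σ + I.cost e))
      rw [hwv]
      linarith
    · rw [if_pos hcov]
      refine mul_le_mul_of_nonneg_left ?_ hpi
      have hpot := I.credit_add_potential_le (hB e) hiH hiE hcov
      have h1 := mul_le_mul_of_nonneg_left hpot (add_nonneg hw0 hv0)
      have h2 := mul_nonneg hv0 hcr
      rw [hwv, hwv']
      linarith

/-! ### Choice of constants -/

theorem potential_empty_le {i : Fin m} (hi : ¬ I.Covered i ∅) {H : Finset (Fin m)}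
    (hH : H.Nonempty) :
    I.potential i ∅ H ≤ 2 * (1 + Real.log (1 / I.eps) + Real.log m) := by
  obtain ⟨h0, -⟩ := I.eps_pos_and_le hi
  have h1 : Real.log ((1 - I.value i ∅) / I.eps) ≤ Real.log (1 / I.eps) := by
    refine Real.log_le_log (div_pos (sub_pos.2 (value_lt_one hi)) h0) ?_
    exact div_le_div_of_nonneg_right (by linarith [I.value_nonneg i ∅]) h0.le
  have h2 : Real.log H.card ≤ Real.log m := by
    refine Real.log_le_log (by exact_mod_cast hH.card_pos) ?_
    exact_mod_cast (Finset.card_le_univ H).trans_eq (Fintype.card_fin m)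
  -- Uses only that `log 2` exceeds 1/2.
  have h3 : Real.log H.card / Real.log 2 ≤ 2 * Real.log H.card := by
    have := Real.log_two_gt_d9
    rw [div_le_iff₀ (by linarith)]
    nlinarith [Real.log_natCast_nonneg H.card]
  have h4 := I.log_one_div_eps_nonneg
  rw [potential]
  linarith

theorem IsGreedyTree.expectedCost_le {I : ASRInstance U Γ m} {A : DecisionTree U Γ}
    (hA : I.IsGreedyTree A) {T : DecisionTree U Γ} (hT : I.Feasible T) :
    I.expectedCost A ≤
      8 * (1 + Real.log (1 / I.eps) + Real.log m) * I.expectedCost T := by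
  classical
  set Λ := 1 + Real.log (1 / I.eps) + Real.log m with hΛ
  have hΛ1 : 1 ≤ Λ := by
    linarith [I.log_one_div_eps_nonneg, Real.log_natCast_nonneg m]
  set H := I.uncovered Finset.univ ∅ with hH
  set r : Fin m → ℝ := fun i => I.remainingCost i ∅ (I.path i A) with hr
  -- The initial potential is at most `2 * Λ`, so `L = 4 * Λ` leaves half of `r` on the left and
  -- yields the factor 8.
  have hmain := GreedyFrom.sum_remainingCost_le (L := 4 * Λ) hA hT (by linarith) le_rfl
    (fun i hi => (I.mem_uncovered.1 hi).2) (by simp)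
  have hle : ∀ i ∈ H, I.prob i * ((0 + r i) / (4 * Λ) * I.potential i ∅ H +
      max 0 (4 * Λ * I.scenarioCost i T - 0) - r i) ≤
      4 * Λ * (I.prob i * I.scenarioCost i T) - 1 / 2 * (I.prob i * r i) := by
    intro i hi
    have hr0 : 0 ≤ r i := I.remainingCost_nonneg _ _ _
    have h1 := I.potential_empty_le (I.mem_uncovered.1 hi).2 ⟨i, hi⟩
    have h2 : (0 + r i) / (4 * Λ) * I.potential i ∅ H ≤ 1 / 2 * r i := by
      calc (0 + r i) / (4 * Λ) * I.potential i ∅ H ≤ (0 + r i) / (4 * Λ) * (2 * Λ) :=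
            mul_le_mul_of_nonneg_left h1 (by positivity)
        _ = 1 / 2 * r i := by field_simp; ring
    rw [sub_zero, max_eq_right (mul_nonneg (by linarith) (I.scenarioCost_nonneg i T))]
    have := mul_le_mul_of_nonneg_left h2 (I.prob_nonneg i)
    linarith
  have hsum := hmain.trans (Finset.sum_le_sum hle)
  rw [Finset.sum_sub_distrib, ← Finset.mul_sum, ← Finset.mul_sum] at hsum
  have hT' : ∑ i ∈ H, I.prob i * I.scenarioCost i T ≤ I.expectedCost T :=
    Finset.sum_le_sum_of_subset_of_nonneg (Finset.subset_univ H)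
      fun i _ _ => mul_nonneg (I.prob_nonneg i) (I.scenarioCost_nonneg i T)
  have hA' : I.expectedCost A ≤ ∑ i ∈ H, I.prob i * r i := by
    calc I.expectedCost A ≤ ∑ i, I.prob i * r i :=
          Finset.sum_le_sum fun i _ => mul_le_mul_of_nonneg_left
            (I.scenarioCost_le_remainingCost hA.feasible) (I.prob_nonneg i)
      _ = ∑ i ∈ H, I.prob i * r i := by
          refine (Finset.sum_subset (Finset.subset_univ H) fun i _ hi => ?_).symm
          have hcov : I.Covered i ∅ := by
            by_contra h
            exact hi (I.mem_uncovered.2 ⟨Finset.mem_univ i, h⟩)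
          rw [hr]
          simp only [I.remainingCost_of_covered hcov, mul_zero]
  have := mul_le_mul_of_nonneg_left hT' (show 0 ≤ 4 * Λ by linarith)
  linarith

end ASRInstance

theorem mainTheorem2 :
    ∃ C : ℝ, 0 < C ∧
      ∀ (U Γ : Type*) [Fintype U] (m : ℕ) (I : ASRInstance U Γ m),
        (∃ A : DecisionTree U Γ, I.IsGreedyTree A) ∧
        ∀ A : DecisionTree U Γ, I.IsGreedyTree A →
          I.Feasible A ∧
          ∀ T : DecisionTree U Γ, I.Feasible T →
            I.expectedCost A ≤
              C * (1 + Real.log (1 / I.eps) + Real.log m) * I.expectedCost T :=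
  ⟨8, by norm_num, fun _ _ _ _ I =>
    ⟨I.exists_greedyFrom ∅ _ fun _ hi => (I.mem_uncovered.1 hi).2, fun _ hA =>
      ⟨hA.feasible, fun _ hT => hA.expectedCost_le hT⟩⟩⟩
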